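/- For an abelian group $B$ the following conditions are equivalent. 1. There exist a family of abelian groups $(A_i)_{i\in I}$ and an ultrafilter $\mathcal U$ on $I$ that is not countably complete (not closed under countable intersections) such that $B$ is a homomorphic image of the ultraproduct $\prod_{i\in I}A_i/\mathcal U$. 2. There exist a sequence of abelian groups $(A_n)_{n\in\omega}$ and a nonprincipal ultrafilter $\mathcal U$ on $\omega$ such that $B$ is a homomorphic image of the ultraproduct $\prod_{n\in\omega}A_n/\mathcal U$. 3. There exist a sequence of abelian groups $(A_n)_{n\in\omega}$ and a filter $\mathcal F$ on $\omega$ with $\bigcap_{S\in\mathcal F}S=\emptyset$ (equivalently, not contained in any principal ultrafilter) such that $B$ is a homomorphic image of the reduced product $\prod_{n\in\omega}A_n/\mathcal F$. 4. There exists a sequence of abelian groups $(A_n)_{n\in\omega}$ such that $B$ is a homomorphic image of $\bigl(\prod_{n\in\omega}A_n\bigr)/\bigoplus_{n\in\omega}A_n$. 5. $B$ is a homomorphic image of an abelian group $C$ admitting a compact Hausdorff group topology. 6. $B$ is cotorsion, i.e. $B$ is a direct summand in every abelian group $A\supseteq B$ such that $A/B$ is torsion-free. 7. $B$ is a homomorphic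 image of an algebraically compact abelian group. Here the reduced product $\prod_{i\in I}A_i/\mathcal F$ is the quotient of $\prod_{i\in I}A_i$ by the subgroup of those $a$ with $\{i\in I: a_i=0\}\in\mathcal F$; "homomorphic image" means image under a surjective homomorphism. An abelian group $C$ is algebraically compact if it is a direct summand in every abelian group $A\supseteq C$ in which it is pure, where $C$ is pure in $A$ if $C\cap nA=nC$ for every positive integer $n$. -/

import Mathlib

/-- The subgroup of a product of abelian groups consisting of the families that vanish
on some member of the filter `F`. -/
def vanishingSubgroup {I : Type*} (A : I → Type*) [∀ i, AddCommGroup (A i)] (F : Filter I) :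
    AddSubgroup (∀ i, A i) where
  carrier := {a | ∀ᶠ i in F, a i = 0}
  zero_mem' := Filter.Eventually.of_forall fun _ => rfl
  add_mem' {a b} ha hb := by
    filter_upwards [ha, hb] with i hi hj
    simp [hi, hj]
  neg_mem' {a} ha := by
    filter_upwards [ha] with i hi
    simp [hi]

/-- The reduced product `∏ A i / F` of a family of abelian groups with respect to a filter:
two families are identified when they agree on a member of `F`. If `F` is an ultrafilter this is
the ultraproduct. -/
abbrev ReducedProduct {I : Type*} (A : I → Type*) [∀ i, AddCommGroup (A i)] (F : Filter I) :
    Type _ :=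
  (∀ i, A i) ⧸ vanishingSubgroup A F

/-- The direct sum `⨁ A i` as a subgroup of the product `∏ A i`. -/
def directSumSubgroup {I : Type*} (A : I → Type*) [∀ i, AddCommGroup (A i)] :
    AddSubgroup (∀ i, A i) :=
  (DFinsupp.coeFnAddMonoidHom : (Π₀ i, A i) →+ ∀ i, A i).range

/-- `B` is a homomorphic image of `C`. -/
def IsHomImage (B C : Type*) [AddCommGroup B] [AddCommGroup C] : Prop :=
  ∃ f : C →+ B, Function.Surjective f

/-- A subgroup `P` of an abelian group `A` is pure if `P ∩ nA = nP` for every positive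
integer `n`. -/
def IsPureSubgroup {A : Type*} [AddCommGroup A] (P : AddSubgroup A) : Prop :=
  ∀ n : ℕ, 0 < n →
    P ⊓ (nsmulAddMonoidHom n : A →+ A).range = P.map (nsmulAddMonoidHom n : A →+ A)

/-- A subgroup `P` of an abelian group `A` is a direct summand if `A = P ⊕ Q` for some
subgroup `Q`. -/
def IsDirectSummand {A : Type*} [AddCommGroup A] (P : AddSubgroup A) : Prop :=
  ∃ Q : AddSubgroup A, IsCompl P Q

universe u

/-- `B` is algebraically compact if it is a direct summand in every overgroup in which it is
pure. Overgroups are given by injective homomorphisms `B →+ A`. -/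
def IsAlgebraicallyCompact (B : Type u) [AddCommGroup B] : Prop :=
  ∀ (A : Type u) [AddCommGroup A] (j : B →+ A), Function.Injective j →
    IsPureSubgroup j.range → IsDirectSummand j.range

/-- `B` is cotorsion if it is a direct summand in every overgroup `A` such that `A / B` is
torsion-free. Overgroups are given by injective homomorphisms `B →+ A`. -/
def IsCotorsion (B : Type u) [AddCommGroup B] : Prop :=
  ∀ (A : Type u) [AddCommGroup A] (j : B →+ A), Function.Injective j →
    IsAddTorsionFree (A ⧸ j.range) → IsDirectSummand j.range

/-! ### Direct summands, retractions and torsion-free quotients -/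

/-! Cotorsion is equivalent to `Ext(ℚ, B) = 0`. As ℚ is the union of the groups `ℤ · 1/n!`, this
says that all systems `x n - (n + 1) x (n + 1) = d n` are solvable in `B`
(`SolvesFactorialSystems`). Solvability passes to images, and it holds in a product modulo its
direct sum because each coordinate then meets only finitely many equations. The reduced products in
question are images of such quotients.

Conversely, let `B` be cotorsion and an image of a free group `F`. If `F` embeds in `C` with
torsion-free quotient, then `B` is an image of `C` (`IsCotorsion.isHomImage`). Suitable `C` are an
ultrapower of `F` and a product of groups of `p`-adic integers, which is compact. Compact groups are
algebraically compact by taking limits of partial retractions, and algebraically compact groups are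
cotorsion because a torsion-free quotient forces purity. -/

theorem isDirectSummand_range_of_retraction {B A : Type*} [AddCommGroup B] [AddCommGroup A]
    (j : B →+ A) (r : A →+ B) (h : ∀ b, r (j b) = b) : IsDirectSummand j.range := by
  refine ⟨r.ker, ?_, ?_⟩
  · rw [disjoint_iff, eq_bot_iff]
    rintro _ ⟨⟨b, rfl⟩, hb⟩
    have hb' : r (j b) = 0 := hb
    rw [h] at hb'
    simp [hb']
  · rw [codisjoint_iff, eq_top_iff]
    intro a _
    refine AddSubgroup.mem_sup.2 ⟨j (r a), ⟨_, rfl⟩, a - j (r a), ?_, by abel⟩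
    simp [AddMonoidHom.mem_ker, h]

theorem IsDirectSummand.exists_retraction {B A : Type*} [AddCommGroup B] [AddCommGroup A]
    {j : B →+ A} (hj : Function.Injective j) (h : IsDirectSummand j.range) :
    ∃ r : A →+ B, ∀ b, r (j b) = b := by
  obtain ⟨Q, hQ⟩ := h
  have hex : ∀ a, ∃ b, a - j b ∈ Q := fun a => by
    have ha : a ∈ j.range ⊔ Q := by rw [hQ.sup_eq_top]; trivial
    obtain ⟨_, ⟨b, rfl⟩, q, hq, rfl⟩ := AddSubgroup.mem_sup.1 ha
    exact ⟨b, by simpa using hq⟩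
  have huniq : ∀ b, j b ∈ Q → b = 0 := fun b hb => by
    have : j b ∈ j.range ⊓ Q := ⟨⟨b, rfl⟩, hb⟩
    rw [hQ.inf_eq_bot, AddSubgroup.mem_bot] at this
    exact hj (by simpa using this)
  choose r hr using hex
  refine ⟨AddMonoidHom.mk' r fun a b => ?_, fun b => ?_⟩
  · rw [← sub_eq_zero]
    apply huniq
    have := Q.sub_mem (Q.add_mem (hr a) (hr b)) (hr (a + b))
    convert this using 1
    simp only [map_sub, map_add]
    abel
  · change r (j b) = b
    rw [← sub_eq_zero]
    apply huniq
    have := Q.neg_mem (hr (j b))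
    convert this using 1
    simp only [map_sub]
    abel

theorem isAddTorsionFree_quotient_iff {A : Type*} [AddCommGroup A] (P : AddSubgroup A) :
    IsAddTorsionFree (A ⧸ P) ↔ ∀ n : ℕ, n ≠ 0 → ∀ a : A, n • a ∈ P → a ∈ P := by
  constructor
  · intro h n hn a ha
    rw [← QuotientAddGroup.eq_zero_iff] at ha ⊢
    rw [QuotientAddGroup.mk_nsmul] at ha
    exact (nsmul_eq_zero_iff_right hn).1 ha
  · refine fun h => ⟨fun n hn x y hxy => ?_⟩
    induction x using QuotientAddGroup.induction_on with | _ a => ?_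
    induction y using QuotientAddGroup.induction_on with | _ b => ?_
    rw [← sub_eq_zero, ← QuotientAddGroup.mk_sub, QuotientAddGroup.eq_zero_iff]
    apply h n hn
    rw [← QuotientAddGroup.eq_zero_iff, QuotientAddGroup.mk_nsmul, QuotientAddGroup.mk_sub,
      nsmul_sub, sub_eq_zero]
    exact hxy

theorem IsHomImage.trans {B C D : Type*} [AddCommGroup B] [AddCommGroup C] [AddCommGroup D]
    (h₁ : IsHomImage B C) (h₂ : IsHomImage C D) : IsHomImage B D := by
  obtain ⟨f, hf⟩ := h₁
  obtain ⟨g, hg⟩ := h₂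
  exact ⟨f.comp g, hf.comp hg⟩

theorem isHomImage_quotient_quotient {C D : Type*} [AddCommGroup C] [AddCommGroup D]
    (P : AddSubgroup C) (Q : AddSubgroup D) (f : D →+ C) (hf : Function.Surjective f)
    (h : ∀ x ∈ Q, f x ∈ P) : IsHomImage (C ⧸ P) (D ⧸ Q) := by
  refine ⟨QuotientAddGroup.map Q P f h, fun y => ?_⟩
  induction y using QuotientAddGroup.induction_on with | _ c => ?_
  obtain ⟨d, rfl⟩ := hf c
  exact ⟨(d : D ⧸ Q), rfl⟩

/-! ### Cotorsion groups as images -/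

/-- A cotorsion group that is an image of `F` is an image of any group in which `F` embeds with
torsion-free quotient. -/
theorem IsCotorsion.isHomImage {B C : Type u} {F : Type*} [AddCommGroup B] [AddCommGroup C]
    [AddCommGroup F] (hB : IsCotorsion B) (f : F →+ B) (hf : Function.Surjective f) (i : F →+ C)
    (hi : Function.Injective i)
    (htf : ∀ n : ℕ, n ≠ 0 → ∀ c : C, n • c ∈ i.range → c ∈ i.range) : IsHomImage B C := by
  -- `C ⧸ K` is the pushout of `B` and `C` over `F`; its quotient by `B` is `C / F`, so cotorsion
  -- splits it.
  let K : AddSubgroup C := f.ker.map i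
  let j : B →+ C ⧸ K := f.liftOfSurjective hf ⟨(QuotientAddGroup.mk' K).comp i, fun x hx => by
    rw [AddMonoidHom.mem_ker, AddMonoidHom.comp_apply, QuotientAddGroup.mk'_apply,
      QuotientAddGroup.eq_zero_iff]
    exact ⟨x, hx, rfl⟩⟩
  have hj : ∀ x, j (f x) = (i x : C ⧸ K) := fun x =>
    AddMonoidHom.liftOfRightInverse_comp_apply f _ (Function.rightInverse_surjInv hf) _ x
  have hjinj : Function.Injective j := by
    rw [injective_iff_map_eq_zero]
    intro b hb
    obtain ⟨x, rfl⟩ := hf b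
    rw [hj, QuotientAddGroup.eq_zero_iff] at hb
    obtain ⟨y, hy, hxy⟩ := hb
    rw [← hi hxy]
    exact hy
  have hmem : ∀ c : C, (c : C ⧸ K) ∈ j.range ↔ c ∈ i.range := fun c => by
    constructor
    · rintro ⟨b, hb⟩
      obtain ⟨x, rfl⟩ := hf b
      rw [hj, eq_comm, ← sub_eq_zero, ← QuotientAddGroup.mk_sub,
        QuotientAddGroup.eq_zero_iff] at hb
      obtain ⟨y, -, hy⟩ := hb
      exact ⟨y + x, by rw [map_add, hy]; abel⟩
    · rintro ⟨x, rfl⟩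
      exact ⟨f x, hj x⟩
  have htf' : IsAddTorsionFree ((C ⧸ K) ⧸ j.range) := by
    rw [isAddTorsionFree_quotient_iff]
    intro n hn a
    induction a using QuotientAddGroup.induction_on with | _ c => ?_
    rw [← QuotientAddGroup.mk_nsmul, hmem, hmem]
    exact htf n hn c
  obtain ⟨r, hr⟩ := (hB _ j hjinj htf').exists_retraction hjinj
  exact ⟨r.comp (QuotientAddGroup.mk' K),
    (Function.RightInverse.surjective hr).comp (QuotientAddGroup.mk'_surjective K)⟩

theorem exists_finsupp_int_surjective (B : Type*) [AddCommGroup B] :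
    ∃ f : (B →₀ ℤ) →+ B, Function.Surjective f :=
  ⟨Finsupp.liftAddHom fun b => zmultiplesHom B b, fun b => ⟨Finsupp.single b 1, by simp⟩⟩

/-! ### Homomorphisms from `ℚ` and divisible groups -/

/-- Any `n!` clearing the denominator of `q` can be used to compute the value at `q`; coherence of
`y` makes the choice irrelevant. -/
theorem exists_rat_hom {I : Type*} [AddCommGroup I] (y : ℕ → I)
    (hy : ∀ n, y n = (n + 1) • y (n + 1)) :
    ∃ f : ℚ →+ I, ∀ n : ℕ, f ((n.factorial : ℚ)⁻¹) = y n := by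
  have hstep : ∀ n k, ∃ c : ℕ, c * n.factorial = (n + k).factorial ∧ y n = c • y (n + k) := by
    intro n k
    induction k with
    | zero => exact ⟨1, by simp⟩
    | succ k ih =>
      obtain ⟨c, hc, hyc⟩ := ih
      refine ⟨(n + k + 1) * c, ?_, ?_⟩
      · rw [mul_assoc, hc, ← add_assoc, Nat.factorial_succ]
      · rw [hyc, hy (n + k), smul_smul, mul_comm, ← add_assoc]
  have hle : ∀ (q : ℚ) (n m : ℕ) (z w : ℤ), n ≤ m → q * n.factorial = z → q * m.factorial = w →
      z • y n = w • y m := by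
    intro q n m z w hnm hz hw
    obtain ⟨k, rfl⟩ := Nat.exists_eq_add_of_le hnm
    obtain ⟨c, hc, hyc⟩ := hstep n k
    have : w = z * c := by
      have : (w : ℚ) = z * c := by
        rw [← hw, ← hz, ← hc]; push_cast; ring
      exact_mod_cast this
    rw [hyc, this, mul_smul, natCast_zsmul]
  have hwd : ∀ (q : ℚ) (n m : ℕ) (z w : ℤ), q * n.factorial = z → q * m.factorial = w →
      z • y n = w • y m := by
    intro q n m z w hz hw
    rcases le_total n m with h | h
    · exact hle q n m z w h hz hw
    · exact (hle q m n w z h hw hz).symm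
  have hex : ∀ (q : ℚ) (m : ℕ), q.den ≤ m → ∃ z : ℤ, q * m.factorial = z := by
    intro q m hm
    obtain ⟨c, hc⟩ := Nat.dvd_factorial q.den_pos hm
    refine ⟨q.num * c, ?_⟩
    rw [hc]
    push_cast
    rw [← mul_assoc, Rat.mul_den_eq_num]
  choose z hz using fun q => hex q q.den le_rfl
  refine ⟨AddMonoidHom.mk' (fun q => z q • y q.den) fun q q' => ?_, fun n => ?_⟩
  · let m := max q.den q'.den
    obtain ⟨a, ha⟩ := hex q m (le_max_left _ _)
    obtain ⟨b, hb⟩ := hex q' m (le_max_right _ _)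
    rw [hwd q _ m _ a (hz q) ha, hwd q' _ m _ b (hz q') hb, ← add_smul]
    exact hwd (q + q') _ _ _ _ (hz _) (by push_cast; rw [add_mul, ha, hb])
  · change z _ • y _ = _
    rw [hwd _ _ n _ 1 (hz _) (by
      push_cast
      exact inv_mul_cancel₀ (Nat.cast_ne_zero.2 n.factorial_ne_zero)), one_smul]

theorem factorial_inv_coherent (n : ℕ) :
    ((n.factorial : ℚ)⁻¹) = (n + 1) • (((n + 1).factorial : ℚ)⁻¹) := by
  have : (n.factorial : ℚ) ≠ 0 := Nat.cast_ne_zero.2 n.factorial_ne_zero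
  have : (n + 1 : ℚ) ≠ 0 := by positivity
  rw [Nat.factorial_succ, nsmul_eq_mul]
  push_cast
  field_simp

theorem rat_hom_ext {I : Type*} [AddCommGroup I] {f g : ℚ →+ I}
    (h : ∀ n : ℕ, f ((n.factorial : ℚ)⁻¹) = g ((n.factorial : ℚ)⁻¹)) : f = g := by
  ext q
  obtain ⟨c, hc⟩ := Nat.dvd_factorial q.den_pos le_rfl
  have hq : q = (q.num * c) • ((q.den.factorial : ℚ)⁻¹) := by
    rw [zsmul_eq_mul, eq_mul_inv_iff_mul_eq₀ (Nat.cast_ne_zero.2 q.den.factorial_ne_zero)]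
    rw [hc]
    push_cast
    rw [← mul_assoc, Rat.mul_den_eq_num]
  rw [hq, map_zsmul, map_zsmul, h]

/-- Every abelian group embeds in a divisible one. -/
theorem exists_divisible_embedding (D : Type u) [AddCommGroup D] :
    ∃ (I : Type u) (_ : AddCommGroup I) (_ : DivisibleBy I ℤ) (e : D →+ I),
      Function.Injective e := by
  refine ⟨CharacterModule D → AddCircle (1 : ℚ), inferInstance, inferInstance,
    AddMonoidHom.mk' (fun d χ => χ d) fun a b => by ext χ; simp, ?_⟩
  rw [injective_iff_map_eq_zero]
  intro d hd
  exact CharacterModule.eq_zero_of_character_apply fun c => congr_fun hd c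

/-! ### Solvability of the equations defining `Ext(ℚ, D) = 0` -/

/-- Solvability in `D` of all systems `x n - (n + 1) x (n + 1) = d n`; this expresses
`Ext(ℚ, D) = 0`. -/
def SolvesFactorialSystems (D : Type*) [AddCommGroup D] : Prop :=
  ∀ d : ℕ → D, ∃ x : ℕ → D, ∀ n, x n - (n + 1) • x (n + 1) = d n

theorem SolvesFactorialSystems.of_isHomImage {B C : Type*} [AddCommGroup B] [AddCommGroup C]
    (hC : SolvesFactorialSystems C) (h : IsHomImage B C) : SolvesFactorialSystems B := by
  obtain ⟨f, hf⟩ := h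
  intro d
  choose e he using fun n => hf (d n)
  obtain ⟨x, hx⟩ := hC e
  exact ⟨fun n => f (x n), fun n => by rw [← he, ← hx, map_sub, map_nsmul]⟩

/-- Arbitrary lifts of the images of `1/n!` fail to be coherent by elements `d n` of `D`; a solution
of the system for `d` corrects them. -/
theorem SolvesFactorialSystems.exists_rat_lift {D I : Type*} [AddCommGroup D] [AddCommGroup I]
    (hD : SolvesFactorialSystems D) (e : D →+ I) (g : ℚ →+ I ⧸ e.range) :
    ∃ f : ℚ →+ I, ∀ q, (f q : I ⧸ e.range) = g q := by
  choose i hi using fun n : ℕ => QuotientAddGroup.mk_surjective (g ((n.factorial : ℚ)⁻¹))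
  have hmem : ∀ n, ∃ d, e d = i n - (n + 1) • i (n + 1) := fun n => by
    rw [← AddMonoidHom.mem_range, ← QuotientAddGroup.eq_zero_iff, QuotientAddGroup.mk_sub,
      QuotientAddGroup.mk_nsmul, hi, hi, ← map_nsmul, ← factorial_inv_coherent, sub_self]
  choose d hd using hmem
  obtain ⟨x, hx⟩ := hD d
  obtain ⟨f, hf⟩ := exists_rat_hom (fun n => i n - e (x n)) fun n => by
    have := hd n
    rw [← hx, map_sub, map_nsmul, sub_eq_sub_iff_add_eq_add] at this
    rw [nsmul_sub, sub_eq_sub_iff_add_eq_add, add_comm, add_comm _ (e (x n)), this, add_comm]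
  refine ⟨f, fun q => ?_⟩
  have : (QuotientAddGroup.mk' e.range).comp f = g := rat_hom_ext fun n => by
    rw [AddMonoidHom.comp_apply, hf, QuotientAddGroup.mk'_apply, QuotientAddGroup.mk_sub, hi,
      (QuotientAddGroup.eq_zero_iff (N := e.range) _).2 ⟨x n, rfl⟩, sub_zero]
  exact DFunLike.congr_fun this q

theorem SolvesFactorialSystems.exists_lift {D I V : Type*} [AddCommGroup D] [AddCommGroup I]
    [AddCommGroup V] [Module ℚ V]
    (hD : SolvesFactorialSystems D) (e : D →+ I) (g : V →+ I ⧸ e.range) :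
    ∃ f : V →+ I, ∀ v, (f v : I ⧸ e.range) = g v := by
  let b := Module.Basis.ofVectorSpace ℚ V
  choose h hh using fun k =>
    hD.exists_rat_lift e (g.comp ((LinearMap.toSpanSingleton ℚ V (b k)).toAddMonoidHom))
  let F := (Finsupp.liftAddHom h).comp b.repr.toLinearMap.toAddMonoidHom
  refine ⟨F, fun v => ?_⟩
  obtain ⟨w, rfl⟩ := b.repr.symm.surjective v
  have key : ((QuotientAddGroup.mk' e.range).comp F).comp b.repr.symm.toLinearMap.toAddMonoidHom
      = g.comp b.repr.symm.toLinearMap.toAddMonoidHom := by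
    refine Finsupp.addHom_ext fun k q => ?_
    simpa [F] using hh k q
  exact DFunLike.congr_fun key w

theorem SolvesFactorialSystems.isCotorsion {D : Type u} [AddCommGroup D]
    (hD : SolvesFactorialSystems D) : IsCotorsion D := by
  intro A _ j hj htf
  obtain ⟨I, _, _, e, he⟩ := exists_divisible_embedding D
  obtain ⟨φ, hφ⟩ := (Module.Baer.of_divisible I).extension_property_addMonoidHom j hj e
  have hφ' : ∀ d, φ (j d) = e d := fun d => DFunLike.congr_fun hφ d
  let ψ : A ⧸ j.range →+ I ⧸ e.range := QuotientAddGroup.map _ _ φ (by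
    rintro _ ⟨d, rfl⟩
    exact ⟨d, (hφ' d).symm⟩)
  let _ : DivisibleBy (I ⧸ e.range) ℤ := (QuotientAddGroup.mk'_surjective e.range).divisibleBy _ fun a n =>
    map_zsmul (QuotientAddGroup.mk' e.range) n a
  obtain ⟨χ, hχ⟩ := (Module.Baer.of_divisible (I ⧸ e.range)).extension_property_addMonoidHom
    (DivisibleHull.coeAddMonoidHom (A ⧸ j.range)) DivisibleHull.coe_injective ψ
  obtain ⟨σ, hσ⟩ := hD.exists_lift e χ
  -- The retraction is `φ - σ ∘ π`: it takes values in `e(D)`, and on `D` it equals `e` since `π`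
  -- vanishes there.
  let π : A →+ DivisibleHull (A ⧸ j.range) :=
    (DivisibleHull.coeAddMonoidHom _).comp (QuotientAddGroup.mk' j.range)
  have hmem : ∀ a, ∃ d, e d = φ a - σ (π a) := fun a => by
    rw [← AddMonoidHom.mem_range, ← QuotientAddGroup.eq_zero_iff, QuotientAddGroup.mk_sub, hσ,
      sub_eq_zero]
    exact (DFunLike.congr_fun hχ (a : A ⧸ j.range)).symm
  choose r hr using hmem
  refine isDirectSummand_range_of_retraction j (AddMonoidHom.mk' r fun a b => he ?_) fun d => he ?_
  · rw [hr, map_add e, hr, hr, map_add, map_add, map_add]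
    abel
  · have : π (j d) = 0 := by
      simp only [π, AddMonoidHom.comp_apply, QuotientAddGroup.mk'_apply]
      rw [(QuotientAddGroup.eq_zero_iff (N := j.range) _).2 ⟨d, rfl⟩, map_zero]
    change e (r (j d)) = e d
    rw [hr, this, map_zero, sub_zero, hφ']

/-- The system has a solution `y` in a divisible overgroup `I`, which defines a map `ℚ → I / D`. Its
pullback along `I → I / D` is an extension of ℚ by `D`; a retraction onto `D` carries `y` to a
solution in `D`. -/
theorem IsCotorsion.solvesFactorialSystems {D : Type u} [AddCommGroup D]
    (hD : IsCotorsion D) : SolvesFactorialSystems D := by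
  intro d
  obtain ⟨I, _, _, e, he⟩ := exists_divisible_embedding D
  let y : ℕ → I := fun n =>
    Nat.rec 0 (fun n z => DivisibleBy.div (z - e (d n)) ((n + 1 : ℕ) : ℤ)) n
  have hy : ∀ n, y n - (n + 1) • y (n + 1) = e (d n) := fun n => by
    have : ((n + 1 : ℕ) : ℤ) • y (n + 1) = y n - e (d n) :=
      DivisibleBy.div_cancel _ (by omega)
    rw [natCast_zsmul] at this
    rw [this]; abel
  obtain ⟨g, hg⟩ := exists_rat_hom (fun n => QuotientAddGroup.mk' e.range (y n)) fun n => by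
    rw [← map_nsmul, ← sub_eq_zero, ← map_sub, hy, QuotientAddGroup.mk'_apply,
      QuotientAddGroup.eq_zero_iff]
    exact ⟨d n, rfl⟩
  let A : AddSubgroup (I × ℚ) :=
    ((QuotientAddGroup.mk' e.range).comp (AddMonoidHom.fst I ℚ)).eqLocus
      (g.comp (AddMonoidHom.snd I ℚ))
  have hA : ∀ p : I × ℚ, p ∈ A ↔ (p.1 : I ⧸ e.range) = g p.2 := fun p => Iff.rfl
  let j : D →+ A := ((AddMonoidHom.inl I ℚ).comp e).codRestrict A fun c => by
    rw [hA]
    simp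
  have hj : Function.Injective j := fun a b hab => he congr(($hab).1.1)
  have hrange : ∀ a : A, a ∈ j.range ↔ a.1.2 = 0 := fun a => by
    constructor
    · rintro ⟨c, rfl⟩
      rfl
    · intro h
      have ha := (hA a.1).1 a.2
      rw [h, map_zero, QuotientAddGroup.eq_zero_iff] at ha
      obtain ⟨c, hc⟩ := ha
      exact ⟨c, Subtype.ext (Prod.ext hc h.symm)⟩
  obtain ⟨r, hr⟩ := (hD A j hj (by
    rw [isAddTorsionFree_quotient_iff]
    intro n hn a
    rw [hrange, hrange]
    intro h
    have h' : n • a.1.2 = 0 := h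
    exact (nsmul_eq_zero_iff_right hn).1 h')).exists_retraction hj
  let t : ℕ → A := fun n => ⟨(y n, (n.factorial : ℚ)⁻¹), (hA _).2 (hg n).symm⟩
  refine ⟨fun n => r (t n), fun n => ?_⟩
  rw [← map_nsmul, ← map_sub, ← hr (d n)]
  congr 1
  refine Subtype.ext (Prod.ext (hy n) ?_)
  change (n.factorial : ℚ)⁻¹ - (n + 1) • (((n + 1).factorial : ℚ)⁻¹) = 0
  rw [← factorial_inv_coherent, sub_self]

theorem IsCotorsion.of_isHomImage {B C : Type u} [AddCommGroup B] [AddCommGroup C]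
    (hC : IsCotorsion C) (h : IsHomImage B C) : IsCotorsion B :=
  (hC.solvesFactorialSystems.of_isHomImage h).isCotorsion

theorem IsAlgebraicallyCompact.isCotorsion {C : Type u} [AddCommGroup C]
    (hC : IsAlgebraicallyCompact C) : IsCotorsion C := by
  intro A _ j hj htf
  rw [isAddTorsionFree_quotient_iff] at htf
  refine hC A j hj fun n hn => le_antisymm ?_ ?_
  · rintro _ ⟨h, a, rfl⟩
    exact ⟨a, htf n hn.ne' a h, rfl⟩
  · rintro _ ⟨_, ⟨c, rfl⟩, rfl⟩
    exact ⟨⟨n • c, map_nsmul j n c⟩, j c, rfl⟩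

/-! ### Compact groups are algebraically compact -/

/-- Homomorphisms from finitely generated groups lift along surjections through which torsion
elements lift with preservation of exponents. -/
theorem exists_lift_of_fg {H A Q : Type*} [AddCommGroup H] [AddCommGroup A] [AddCommGroup Q]
    [AddGroup.FG H] (π : A →+ Q) (hπ : Function.Surjective π)
    (htors : ∀ n : ℕ, 0 < n → ∀ q : Q, n • q = 0 → ∃ a, π a = q ∧ n • a = 0) (g : H →+ Q) :
    ∃ s : H →+ A, ∀ x, π (s x) = g x := by
  -- Generators of the free part lift arbitrarily, those of the finite cyclic summands by `htors`.
  obtain ⟨n, ι, _, p, hp, e, ⟨E⟩⟩ := AddCommGroup.equiv_free_prod_directSum_zmod H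
  classical
  let g₁ : (Fin n →₀ ℤ) →+ Q := (g.comp E.symm.toAddMonoidHom).comp (AddMonoidHom.inl _ _)
  let g₂ : (DirectSum ι fun i => ZMod (p i ^ e i)) →+ Q :=
    (g.comp E.symm.toAddMonoidHom).comp (AddMonoidHom.inr _ _)
  choose a ha using fun k => hπ (g₁ (Finsupp.single k 1))
  have hb : ∀ i, ∃ b, π b = g₂ (DirectSum.of _ i 1) ∧ (p i ^ e i) • b = 0 := fun i => by
    refine htors _ (pow_pos (hp i).pos _) _ ?_
    rw [← map_nsmul, ← map_nsmul, nsmul_eq_mul, CharP.cast_eq_zero, zero_mul, map_zero, map_zero]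
  choose b hb hb0 using hb
  let s₁ : (Fin n →₀ ℤ) →+ A := Finsupp.liftAddHom fun k => zmultiplesHom A (a k)
  let s₂ : (DirectSum ι fun i => ZMod (p i ^ e i)) →+ A := DirectSum.toAddMonoid fun i =>
    ZMod.lift (p i ^ e i) ⟨zmultiplesHom A (b i), by
      rw [zmultiplesHom_apply, natCast_zsmul, hb0]⟩
  have h₁ : π.comp s₁ = g₁ := by
    refine Finsupp.addHom_ext' fun k => AddMonoidHom.ext_int ?_
    simp [s₁, ha]
  have h₂ : π.comp s₂ = g₂ := by
    refine DirectSum.addHom_ext' fun i => AddMonoidHom.ext fun z => ?_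
    obtain ⟨z, rfl⟩ := ZMod.intCast_surjective z
    have : (z : ZMod (p i ^ e i)) = z • 1 := by simp
    rw [AddMonoidHom.comp_apply, AddMonoidHom.comp_apply, DirectSum.toAddMonoid_of, ZMod.lift_coe,
      zmultiplesHom_apply, map_zsmul, hb, this]
    exact (map_zsmul (g₂.comp (DirectSum.of _ i)) z 1).symm
  refine ⟨(s₁.coprod s₂).comp E.toAddMonoidHom, fun x => ?_⟩
  obtain ⟨⟨y, z⟩, rfl⟩ := E.symm.surjective x
  have hy := DFunLike.congr_fun h₁ y
  have hz := DFunLike.congr_fun h₂ z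
  simp only [AddMonoidHom.comp_apply] at hy hz
  rw [AddMonoidHom.comp_apply, AddEquiv.coe_toAddMonoidHom, AddEquiv.apply_symm_apply,
    AddMonoidHom.coprod_apply, map_add, hy, hz]
  simp [g₁, g₂, ← map_add]

/-- A pure embedding has, for each finite subset of the overgroup, a retraction that is additive
on that subset. -/
theorem IsPureSubgroup.exists_finite_retraction {C A : Type*} [AddCommGroup C] [AddCommGroup A]
    {j : C →+ A} (hj : Function.Injective j) (hp : IsPureSubgroup j.range) (T : Finset A) :
    ∃ r : A → C, (∀ c, r (j c) = c) ∧ ∀ a ∈ T, ∀ b ∈ T, r (a + b) = r a + r b := by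
  let π := QuotientAddGroup.mk' j.range
  have hπ : Function.Surjective π := QuotientAddGroup.mk'_surjective _
  have hker : ∀ a, π a = 0 ↔ ∃ c, j c = a := fun a => QuotientAddGroup.eq_zero_iff a
  let H : AddSubgroup (A ⧸ j.range) := AddSubgroup.closure (π '' T)
  have : AddGroup.FG H := AddGroup.closure_finite_fg _
  -- Purity provides the lifting of torsion elements; the retraction is then `a ↦ a - s (π a)`
  -- wherever `π a ∈ H`.
  obtain ⟨s, hs⟩ := exists_lift_of_fg (H := H) π hπ (fun n hn q hq => by
    obtain ⟨a, rfl⟩ := hπ q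
    rw [← map_nsmul, hker] at hq
    obtain ⟨c, hc⟩ := hq
    have hmem : j c ∈ j.range ⊓ (nsmulAddMonoidHom n : A →+ A).range := ⟨⟨c, rfl⟩, a, hc.symm⟩
    rw [hp n hn] at hmem
    obtain ⟨_, ⟨d, rfl⟩, hd⟩ := hmem
    have hd' : n • j d = j c := hd
    refine ⟨a - j d, ?_, ?_⟩
    · rw [map_sub, (hker (j d)).2 ⟨d, rfl⟩, sub_zero]
    · rw [nsmul_sub, hd', hc, sub_self]) H.subtype
  classical
  have hr : ∀ a, ∃ c, ∀ h : π a ∈ H, j c = a - s ⟨π a, h⟩ := fun a => by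
    by_cases h : π a ∈ H
    · obtain ⟨c, hc⟩ := (hker (a - s ⟨π a, h⟩)).1 (by
        rw [map_sub, hs]
        exact sub_self _)
      exact ⟨c, fun _ => hc⟩
    -- The default is harmless: `C`, `T` and sums of two elements of `T` all map into `H`.
    · exact ⟨0, fun h' => (h h').elim⟩
  choose r hr using hr
  refine ⟨r, fun c => hj ?_, fun a ha b hb => hj ?_⟩
  · have h0 : π (j c) = 0 := (hker _).2 ⟨c, rfl⟩
    have h : π (j c) ∈ H := h0 ▸ H.zero_mem
    have h1 : (⟨π (j c), h⟩ : H) = 0 := Subtype.ext h0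
    rw [hr _ h, h1, map_zero, sub_zero]
  · have hTH : ∀ a ∈ T, π a ∈ H := fun a ha => AddSubgroup.subset_closure ⟨a, ha, rfl⟩
    have h : π (a + b) ∈ H := by
      rw [map_add]
      exact H.add_mem (hTH a ha) (hTH b hb)
    have h1 : (⟨π (a + b), h⟩ : H) = ⟨π a, hTH a ha⟩ + ⟨π b, hTH b hb⟩ :=
      Subtype.ext (map_add π a b)
    rw [map_add, hr _ h, hr _ (hTH a ha), hr _ (hTH b hb), h1, map_add]
    abel

open Filter Topology in
-- The retractions additive on finite sets converge pointwise along an ultrafilter on the finite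
-- subsets of `A`, by Tychonoff. Each instance of additivity holds eventually, so it survives in the
-- limit.
theorem isAlgebraicallyCompact_of_compactSpace (C : Type u) [AddCommGroup C] [TopologicalSpace C]
    [IsTopologicalAddGroup C] [CompactSpace C] [T2Space C] : IsAlgebraicallyCompact C := by
  intro A _ j hj hp
  choose r hr hadd using fun T => hp.exists_finite_retraction hj T
  let U : Ultrafilter (Finset A) := Ultrafilter.of atTop
  have hU : ∀ a : A, ∀ᶠ T in (U : Filter (Finset A)), a ∈ T := fun a =>
    Ultrafilter.of_le atTop (by
      filter_upwards [eventually_ge_atTop {a}] with T hT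
      exact Finset.singleton_subset_iff.1 hT)
  obtain ⟨ρ, -, hρ⟩ := isCompact_univ.ultrafilter_le_nhds (U.map r) (by simp)
  have hlim : ∀ a, Tendsto (fun T => r T a) (U : Filter (Finset A)) (𝓝 (ρ a)) :=
    tendsto_pi_nhds.1 hρ
  refine isDirectSummand_range_of_retraction j (AddMonoidHom.mk' ρ fun a b => ?_) fun c => ?_
  · refine tendsto_nhds_unique (hlim (a + b)) (((hlim a).add (hlim b)).congr' ?_)
    filter_upwards [hU a, hU b] with T ha hb
    exact (hadd T a ha b hb).symm
  · refine tendsto_nhds_unique (hlim (j c)) (tendsto_const_nhds.congr fun T => ?_)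
    exact (hr T c).symm

/-! ### Reduced products -/

theorem mem_directSumSubgroup_iff {I : Type*} (A : I → Type*) [∀ i, AddCommGroup (A i)]
    (a : ∀ i, A i) : a ∈ directSumSubgroup A ↔ ∃ s : Finset I, ∀ i ∉ s, a i = 0 := by
  classical
  constructor
  · rintro ⟨f, rfl⟩
    exact ⟨f.support, fun i hi => DFinsupp.notMem_support_iff.1 hi⟩
  · rintro ⟨s, hs⟩
    refine ⟨DFinsupp.mk s fun i => a i, funext fun i => ?_⟩
    by_cases hi : i ∈ s
    · simp [hi]
    · simp [hi, hs i hi]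

theorem solvesFactorialSystems_pi_quotient_directSum (A : ℕ → Type*) [∀ n, AddCommGroup (A n)] :
    SolvesFactorialSystems ((∀ n, A n) ⧸ directSumSubgroup A) := by
  intro d
  choose e he using fun n => QuotientAddGroup.mk_surjective (d n)
  -- in the `k`-th coordinate, the first `k` equations are solved downwards from `0`
  have hsol : ∀ k m, ∃ x : ℕ → A k, ∀ n < m, x n - (n + 1) • x (n + 1) = e n k := by
    intro k m
    -- `w l` is the unknown of index `m - l`, starting from `x m = 0`.
    let w : ℕ → A k := fun l =>
      Nat.rec 0 (fun l z => e (m - (l + 1)) k + (m - (l + 1) + 1) • z) l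
    refine ⟨fun n => w (m - n), fun n hn => ?_⟩
    obtain ⟨l, hl⟩ : ∃ l, m - n = l + 1 := ⟨m - n - 1, by omega⟩
    have h1 : m - (n + 1) = l := by omega
    have h2 : m - (l + 1) = n := by omega
    have h3 : w (l + 1) = e (m - (l + 1)) k + (m - (l + 1) + 1) • w l := rfl
    simp only [hl, h1, h3, h2]
    abel
  choose x hx using fun k => hsol k k
  refine ⟨fun n => QuotientAddGroup.mk fun k => x k n, fun n => ?_⟩
  rw [← he, ← QuotientAddGroup.mk_nsmul, ← QuotientAddGroup.mk_sub, ← sub_eq_zero,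
    ← QuotientAddGroup.mk_sub, QuotientAddGroup.eq_zero_iff, mem_directSumSubgroup_iff]
  refine ⟨Finset.range (n + 1), fun k hk => ?_⟩
  rw [Finset.mem_range, not_lt] at hk
  exact sub_eq_zero.2 (hx k n hk)

theorem isHomImage_reducedProduct_pi_quotient_directSum (A : ℕ → Type*)
    [∀ n, AddCommGroup (A n)] (F : Filter ℕ) (hF : ⋂₀ F.sets = ∅) :
    IsHomImage (ReducedProduct A F) ((∀ n, A n) ⧸ directSumSubgroup A) := by
  refine isHomImage_quotient_quotient _ _ (AddMonoidHom.id _) Function.surjective_id ?_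
  intro a ha
  obtain ⟨s, hs⟩ := (mem_directSumSubgroup_iff A a).1 ha
  have hne : ∀ n, ∀ᶠ k in F, k ≠ n := fun n => by
    have : n ∉ ⋂₀ F.sets := by simp [hF]
    simp only [Set.mem_sInter, not_forall] at this
    obtain ⟨S, hS, hn⟩ := this
    filter_upwards [hS] with k hk h
    exact hn (h ▸ hk)
  change ∀ᶠ k in F, a k = 0
  filter_upwards [(Filter.eventually_all_finset s).2 fun n _ => hne n] with k hk
  exact hs k fun h => hk k h rfl

theorem sInter_sets_eq_empty_of_nonprincipal {I : Type*} (U : Ultrafilter I)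
    (hU : ∀ i, U ≠ pure i) : ⋂₀ (U : Filter I).sets = ∅ := by
  refine Set.eq_empty_of_forall_notMem fun i hi => hU i ?_
  refine Ultrafilter.coe_injective (U.neBot.eq_pure_iff.2 ?_)
  by_contra h
  exact hi _ (Ultrafilter.compl_mem_iff_notMem.2 h) rfl

/-- An ultrafilter that is not countably complete admits a partition of the index set into
countably many sets outside the ultrafilter. -/
theorem exists_level_of_not_countableInterFilter {I : Type*} (U : Ultrafilter I)
    (hU : ¬ CountableInterFilter (U : Filter I)) :
    ∃ l : I → ℕ, ∀ n, ∀ᶠ i in (U : Filter I), l i ≠ n := by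
  classical
  obtain ⟨S, hS, hmem, hnot⟩ : ∃ S : Set (Set I), S.Countable ∧ (∀ s ∈ S, s ∈ (U : Filter I)) ∧
      ⋂₀ S ∉ (U : Filter I) := by
    by_contra h
    push Not at h
    exact hU ⟨h⟩
  have hne : S.Nonempty := by
    rw [Set.nonempty_iff_ne_empty]
    rintro rfl
    exact hnot (by simp)
  obtain ⟨s, rfl⟩ := hS.exists_eq_range hne
  have hs : ∀ n, s n ∈ (U : Filter I) := fun n => hmem _ ⟨n, rfl⟩
  have hcompl : (⋂₀ Set.range s)ᶜ ∈ (U : Filter I) := Ultrafilter.compl_mem_iff_notMem.2 hnot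
  -- The level of `i` is the first `n` with `i ∉ s n`; the default occurs only on `⋂ s n`, which is
  -- not in `U`.
  refine ⟨fun i => if h : ∃ n, i ∉ s n then Nat.find h else 0, fun n => ?_⟩
  filter_upwards [hs n, hcompl] with i hi hi'
  have h : ∃ n, i ∉ s n := by simpa using hi'
  rw [dif_pos h]
  rintro rfl
  exact Nat.find_spec h hi

/-- The factors are grouped by level. Finitely many levels together are still negligible for `U`, so
the direct sum of the blocks dies in the ultraproduct. -/
theorem exists_pi_quotient_directSum_of_not_countableInterFilter {I : Type u} (A : I → Type u)
    [∀ i, AddCommGroup (A i)] (U : Ultrafilter I) (hU : ¬ CountableInterFilter (U : Filter I)) :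
    ∃ (A' : ℕ → Type u) (_ : ∀ n, AddCommGroup (A' n)),
      IsHomImage (ReducedProduct A (U : Filter I)) ((∀ n, A' n) ⧸ directSumSubgroup A') := by
  obtain ⟨l, hl⟩ := exists_level_of_not_countableInterFilter U hU
  refine ⟨fun n => ∀ i : {i // l i = n}, A i, fun n => inferInstance, ?_⟩
  refine isHomImage_quotient_quotient _ _
    (AddMonoidHom.mk' (fun a i => a (l i) ⟨i, rfl⟩) fun a b => rfl) (fun a => ?_) fun a ha => ?_
  · exact ⟨fun n i => a i, rfl⟩
  · obtain ⟨s, hs⟩ := (mem_directSumSubgroup_iff _ a).1 ha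
    change ∀ᶠ i in (U : Filter I), a (l i) ⟨i, rfl⟩ = 0
    filter_upwards [(Filter.eventually_all_finset s).2 fun n _ => hl n] with i hi
    rw [hs (l i) fun h => hi _ h rfl]
    rfl

theorem not_countableInterFilter_of_sInter_sets_eq_empty {I : Type*} [Countable I]
    (F : Filter I) [F.NeBot] (hF : ⋂₀ F.sets = ∅) : ¬ CountableInterFilter F := by
  intro h
  have hne : ∀ i, ∃ s ∈ F, i ∉ s := fun i => by
    have : i ∉ ⋂₀ F.sets := by simp [hF]
    simpa using this
  choose s hs his using hne
  have : (⋂ i, s i) ∈ F := countable_iInter_mem.2 hs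
  refine F.empty_notMem (Filter.mem_of_superset this fun i hi => his i ?_)
  exact Set.mem_iInter.1 hi i

/-- Change of the index set of a reduced product along an equivalence. -/
theorem isHomImage_reducedProduct_comp_equiv {I J : Type*} (A : I → Type*)
    [∀ i, AddCommGroup (A i)] (F : Filter I) (e : J ≃ I) :
    IsHomImage (ReducedProduct A F) (ReducedProduct (fun k => A (e k)) (F.map e.symm)) := by
  refine isHomImage_quotient_quotient _ _
    (AddMonoidHom.mk' (fun a => e.piCongrLeft A a) fun a b => ?_) (e.piCongrLeft A).surjective
    fun a ha => ?_
  · ext i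
    obtain ⟨k, rfl⟩ := e.surjective i
    simp [Equiv.piCongrLeft_apply_apply]
  · change ∀ᶠ i in F, e.piCongrLeft A a i = 0
    have ha' : ∀ᶠ i in F, a (e.symm i) = 0 := ha
    filter_upwards [ha'] with i hi
    obtain ⟨k, rfl⟩ := e.surjective i
    rw [Equiv.symm_apply_apply] at hi
    simp [Equiv.piCongrLeft_apply_apply, hi]

/-- A torsion-free group embeds diagonally in its reduced powers with torsion-free quotient. -/
theorem exists_embedding_reducedProduct {I : Type*} (G : Type*) [AddCommGroup G]
    [IsAddTorsionFree G] (F : Filter I) [F.NeBot] :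
    ∃ i : G →+ ReducedProduct (fun _ : I => G) F, Function.Injective i ∧
      ∀ n : ℕ, n ≠ 0 → ∀ c, n • c ∈ i.range → c ∈ i.range := by
  refine ⟨(QuotientAddGroup.mk' _).comp (Pi.constAddMonoidHom I G), ?_, ?_⟩
  · rw [injective_iff_map_eq_zero]
    intro g hg
    have hg' : ∀ᶠ _ in F, g = 0 := (QuotientAddGroup.eq_zero_iff _).1 hg
    exact hg'.exists.choose_spec
  · intro n hn c
    induction c using QuotientAddGroup.induction_on with | _ a => ?_
    rintro ⟨g, hg⟩
    have hg' : ∀ᶠ i in F, g - n • a i = 0 := by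
      rw [← QuotientAddGroup.mk_nsmul] at hg
      have := sub_eq_zero.2 hg
      exact (QuotientAddGroup.eq_zero_iff (Function.const I g - n • a)).1 this
    obtain ⟨i, hi⟩ := hg'.exists
    -- Almost all `a k` satisfy `n • a k = g`, so by torsion-freeness they agree with the single
    -- value `a i`.
    refine ⟨a i, ?_⟩
    rw [← sub_eq_zero]
    refine (QuotientAddGroup.eq_zero_iff (Function.const I (a i) - a)).2 ?_
    change ∀ᶠ k in F, a i - a k = 0
    filter_upwards [hg'] with k hk
    rw [sub_eq_zero]
    apply nsmul_right_injective hn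
    change n • a i = n • a k
    rw [← sub_eq_zero.1 hi, ← sub_eq_zero.1 hk]

/-! ### Free groups in products of `p`-adic integers -/

instance fact_prime_primes (p : Nat.Primes) : Fact (p : ℕ).Prime := ⟨p.2⟩

theorem forall_nsmul_mem_of_forall_prime {C : Type*} [AddCommGroup C] (P : AddSubgroup C)
    (h : ∀ p : ℕ, p.Prime → ∀ c, p • c ∈ P → c ∈ P) (n : ℕ) (hn : n ≠ 0) :
    ∀ c, n • c ∈ P → c ∈ P := by
  induction n using induction_on_primes with
  | zero => exact (hn rfl).elim
  | one => simp
  | prime_mul p m hp ih =>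
    intro c hc
    rw [mul_smul] at hc
    exact ih (right_ne_zero_of_mul hn) c (h p hp _ hc)

/-- Divisibility of an integer by `p` is detected in `ℤ_[p]`, so having a factor for every prime
makes the quotient torsion-free. -/
theorem exists_embedding_pi_padicInt (X : Type*) :
    ∃ i : (X →₀ ℤ) →+ (X → ∀ p : Nat.Primes, ℤ_[p]), Function.Injective i ∧
      ∀ n : ℕ, n ≠ 0 → ∀ c, n • c ∈ i.range → c ∈ i.range := by
  let i : (X →₀ ℤ) →+ (X → ∀ p : Nat.Primes, ℤ_[p]) :=
    AddMonoidHom.mk' (fun f x p => (f x : ℤ_[p])) fun f g => by ext; simp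
  have hi : ∀ f x p, i f x p = (f x : ℤ_[p]) := fun _ _ _ => rfl
  refine ⟨i, fun f g h => ?_, forall_nsmul_mem_of_forall_prime _ fun p hp c => ?_⟩
  · ext x
    have : (f x : ℤ_[2]) = (g x : ℤ_[2]) := congr_fun (congr_fun h x) ⟨2, Nat.prime_two⟩
    exact_mod_cast this
  · rintro ⟨f, hf⟩
    have hdvd : ∀ x, (p : ℤ) ∣ f x := fun x => by
      have : Fact p.Prime := ⟨hp⟩
      have h : (f x : ℤ_[p]) = p • c x ⟨p, hp⟩ := congr_fun (congr_fun hf x) ⟨p, hp⟩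
      rw [← PadicInt.norm_intCast_lt_one_iff (p := p)]
      refine (PadicInt.norm_lt_one_iff_dvd _).2 ⟨c x ⟨p, hp⟩, ?_⟩
      simpa using h
    refine ⟨f.mapRange (· / (p : ℤ)) (by simp), ?_⟩
    ext x q : 2
    have h := congr_fun (congr_fun hf x) q
    rw [hi] at h ⊢
    have hp0 : (p : ℤ_[q]) ≠ 0 := Nat.cast_ne_zero.2 hp.ne_zero
    apply mul_left_cancel₀ hp0
    obtain ⟨m, hm⟩ := hdvd x
    have : f.mapRange (· / (p : ℤ)) (by simp) x = m := by
      simp [hm, hp.ne_zero]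
    rw [this, ← Int.cast_natCast, ← Int.cast_mul, ← hm, h]
    simp

theorem proposition5p4 (B : Type u) [AddCommGroup B] :
    List.TFAE [
      -- image of an ultraproduct over an ultrafilter that is not countably complete
      ∃ (I : Type u) (A : I → Type u) (_ : ∀ i, AddCommGroup (A i)) (U : Ultrafilter I),
        ¬ CountableInterFilter (U : Filter I) ∧ IsHomImage B (ReducedProduct A (U : Filter I)),
      -- image of an ultraproduct over a nonprincipal ultrafilter on the natural numbers
      ∃ (A : ℕ → Type u) (_ : ∀ n, AddCommGroup (A n)) (U : Ultrafilter ℕ),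
        (∀ n : ℕ, U ≠ pure n) ∧ IsHomImage B (ReducedProduct A (U : Filter ℕ)),
      -- image of a reduced product over a filter on the natural numbers with empty intersection
      ∃ (A : ℕ → Type u) (_ : ∀ n, AddCommGroup (A n)) (F : Filter ℕ),
        ⋂₀ F.sets = ∅ ∧ IsHomImage B (ReducedProduct A F),
      -- image of the product of a sequence of groups modulo its direct sum
      ∃ (A : ℕ → Type u) (_ : ∀ n, AddCommGroup (A n)),
        IsHomImage B ((∀ n, A n) ⧸ directSumSubgroup A),
      -- image of a group admitting a compact Hausdorff group topology
      ∃ (C : Type u) (_ : AddCommGroup C) (_ : TopologicalSpace C),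
        IsTopologicalAddGroup C ∧ CompactSpace C ∧ T2Space C ∧ IsHomImage B C,
      -- cotorsion
      IsCotorsion B,
      -- image of an algebraically compact group
      ∃ (C : Type u) (_ : AddCommGroup C), IsAlgebraicallyCompact C ∧ IsHomImage B C] := by
  tfae_have 2 → 1 := by
    rintro ⟨A, _, U, hU, hB⟩
    -- The index type must live in `Type u`, so the ultrafilter is transported to a lift of `ℕ`.
    refine ⟨ULift.{u} ℕ, fun k => A (Equiv.ulift k), fun k => inferInstance,
      U.map Equiv.ulift.symm, ?_,
      hB.trans (isHomImage_reducedProduct_comp_equiv A (U : Filter ℕ) Equiv.ulift)⟩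
    refine not_countableInterFilter_of_sInter_sets_eq_empty _
      (sInter_sets_eq_empty_of_nonprincipal _ fun k hk => hU k.down ?_)
    have := congr_arg (Ultrafilter.map Equiv.ulift) hk
    rwa [Ultrafilter.map_map, Equiv.self_comp_symm, Ultrafilter.map_id,
      Ultrafilter.map_pure] at this
  tfae_have 2 → 3 := by
    rintro ⟨A, _, U, hU, hB⟩
    exact ⟨A, _, U, sInter_sets_eq_empty_of_nonprincipal U hU, hB⟩
  tfae_have 1 → 4 := by
    rintro ⟨I, A, _, U, hU, hB⟩
    obtain ⟨A', _, h⟩ := exists_pi_quotient_directSum_of_not_countableInterFilter A U hU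
    exact ⟨A', _, hB.trans h⟩
  tfae_have 3 → 4 := by
    rintro ⟨A, _, F, hF, hB⟩
    exact ⟨A, _, hB.trans (isHomImage_reducedProduct_pi_quotient_directSum A F hF)⟩
  tfae_have 4 → 6 := by
    rintro ⟨A, _, hB⟩
    exact ((solvesFactorialSystems_pi_quotient_directSum A).of_isHomImage hB).isCotorsion
  tfae_have 6 → 2 := by
    intro hB
    obtain ⟨f, hf⟩ := exists_finsupp_int_surjective B
    obtain ⟨i, hi, htf⟩ := exists_embedding_reducedProduct (B →₀ ℤ)
      (Filter.hyperfilter ℕ : Filter ℕ)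
    refine ⟨fun _ => B →₀ ℤ, _, Filter.hyperfilter ℕ, fun n h => ?_,
      hB.isHomImage f hf i hi htf⟩
    have : ({n} : Set ℕ) ∈ Filter.hyperfilter ℕ := by
      rw [h]
      exact Set.mem_singleton n
    exact Filter.notMem_hyperfilter_of_finite (Set.finite_singleton n) this
  tfae_have 6 → 5 := by
    intro hB
    obtain ⟨f, hf⟩ := exists_finsupp_int_surjective B
    obtain ⟨i, hi, htf⟩ := exists_embedding_pi_padicInt B
    exact ⟨B → ∀ p : Nat.Primes, ℤ_[p], inferInstance, inferInstance, inferInstance,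
      inferInstance, inferInstance, hB.isHomImage f hf i hi htf⟩
  tfae_have 5 → 7 := by
    rintro ⟨C, _, _, _, _, _, hB⟩
    exact ⟨C, _, isAlgebraicallyCompact_of_compactSpace C, hB⟩
  tfae_have 7 → 6 := by
    rintro ⟨C, _, hC, hB⟩
    exact hC.isCotorsion.of_isHomImage hB
  tfae_finish
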